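/- Fix an infinite set $N$. The formulas of the language of second-order logic are built from individual variables $x_0,x_1,\dots$ and, for each $n\ge 1$, $n$-ary predicate variables $A^n_0,A^n_1,\dots$. The atomic formulas are $x_i=x_j$, $A^n_i=A^n_j$ and $A^n_i x_{i_1}\cdots x_{i_n}$; the connectives are $\neg,\wedge,\vee,\to,\leftrightarrow$; the quantifiers $\forall,\exists$ may be applied to individual and predicate variables, always in front of a formula in which the variable is not already bound. Let $\Sigma_0$ be the basic Fraenkel model of second order over $N$: its individuals are the elements of $N$, and for $n\ge 1$ its domain $J_n$ of $n$-ary predicates consists of all $\alpha:N^n\to\{\mathrm{true},\mathrm{false}\}$ for which there is a finite set $P\subseteq N$ such that $\alpha(\pi^{-1}(\xi_1),\dots,\pi^{-1}(\xi_n))=\alpha(\xi_1,\dots,\xi_n)$ for all $(\xi_1,\dots,\xi_n)\in N^n$ and every permutation $\pi$ of $N$ that fixes all elements of $P$. Quantifiers over individual variables range over $N$ and quantifiers over $n$-ary predicate variables range over $J_n$; $\Sigma_0\models F$ means that $F$ is true in $\Sigma_0$ under every assignment of elements of $N$ to the individual variables and of elements of $J_n$ to the $n$-ary predicate variables ($n\ge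 1$). Let $n,m\ge 1$, let $\mathbf x=(x_1,\dots,x_n)$ and $\mathbf y=(y_1,\dots,y_m)$ be tuples of individual variables, all $n+m$ of them pairwise distinct, and let $D$ be an $m$-ary predicate variable. Let $H=H(\mathbf x,D)$ be any formula in which $x_1,\dots,x_n$ and $D$ are not bound (further free variables are allowed), and let $S$ be an $(n+m)$-ary predicate variable that does not occur in $H$. Then \[ \Sigma_0\models\ \forall \mathbf x\,\exists D\,H(\mathbf x,D)\ \to\ \exists S\,\forall\mathbf x\,\exists D\,\bigl(\forall\mathbf y\,(D\mathbf y\leftrightarrow S\mathbf x\mathbf y)\wedge H(\mathbf x,D)\bigr). \] -/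

import Mathlib

namespace HPL

/-! ### The language -/

/-- Predicate variables `A_i^n` of sort `n`, `n ≥ 1`, `i ≥ 0` (there are none of sort `0`).
Individual variables `x_i` are represented by their index `i : ℕ`. -/
structure PredVar (n : ℕ) where
  pos : 1 ≤ n
  idx : ℕ
  deriving DecidableEq

/-- Expressions built from the atomic formulas by connectives and quantifiers
of both kinds. -/
inductive Expr : Type
  | rel {n : ℕ} (A : PredVar n) (v : Fin n → ℕ) : Expr
  | eqInd (i j : ℕ) : Expr
  | eqPred {n : ℕ} (A B : PredVar n) : Expr
  | neg (H : Expr) : Expr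
  | conj (H₁ H₂ : Expr) : Expr
  | disj (H₁ H₂ : Expr) : Expr
  | impl (H₁ H₂ : Expr) : Expr
  | equi (H₁ H₂ : Expr) : Expr
  | allInd (i : ℕ) (H : Expr) : Expr
  | exInd (i : ℕ) (H : Expr) : Expr
  | allPred {n : ℕ} (A : PredVar n) (H : Expr) : Expr
  | exPred {n : ℕ} (A : PredVar n) (H : Expr) : Expr

namespace Expr

/-- The individual variables that are quantified somewhere in the expression. -/
def boundInd : Expr → Set ℕ
  | rel _ _ => ∅
  | eqInd _ _ => ∅
  | eqPred _ _ => ∅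
  | neg H => H.boundInd
  | conj H₁ H₂ => H₁.boundInd ∪ H₂.boundInd
  | disj H₁ H₂ => H₁.boundInd ∪ H₂.boundInd
  | impl H₁ H₂ => H₁.boundInd ∪ H₂.boundInd
  | equi H₁ H₂ => H₁.boundInd ∪ H₂.boundInd
  | allInd i H => insert i H.boundInd
  | exInd i H => insert i H.boundInd
  | allPred _ H => H.boundInd
  | exPred _ H => H.boundInd

/-- The predicate variables that are quantified somewhere in the expression. -/
def boundPred : Expr → Set (Sigma PredVar)
  | rel _ _ => ∅
  | eqInd _ _ => ∅
  | eqPred _ _ => ∅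
  | neg H => H.boundPred
  | conj H₁ H₂ => H₁.boundPred ∪ H₂.boundPred
  | disj H₁ H₂ => H₁.boundPred ∪ H₂.boundPred
  | impl H₁ H₂ => H₁.boundPred ∪ H₂.boundPred
  | equi H₁ H₂ => H₁.boundPred ∪ H₂.boundPred
  | allInd _ H => H.boundPred
  | exInd _ H => H.boundPred
  | allPred A H => insert ⟨_, A⟩ H.boundPred
  | exPred A H => insert ⟨_, A⟩ H.boundPred

/-- The predicate variables that occur (free or bound) in the expression. -/
def occPred : Expr → Set (Sigma PredVar)
  | rel A _ => {⟨_, A⟩}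
  | eqInd _ _ => ∅
  | eqPred A B => {⟨_, A⟩, ⟨_, B⟩}
  | neg H => H.occPred
  | conj H₁ H₂ => H₁.occPred ∪ H₂.occPred
  | disj H₁ H₂ => H₁.occPred ∪ H₂.occPred
  | impl H₁ H₂ => H₁.occPred ∪ H₂.occPred
  | equi H₁ H₂ => H₁.occPred ∪ H₂.occPred
  | allInd _ H => H.occPred
  | exInd _ H => H.occPred
  | allPred A H => insert ⟨_, A⟩ H.occPred
  | exPred A H => insert ⟨_, A⟩ H.occPred

/-- The formation rules for formulas: a variable may be quantified only in front of a formula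
in which it is not already quantified. -/
def IsFormula : Expr → Prop
  | rel _ _ => True
  | eqInd _ _ => True
  | eqPred _ _ => True
  | neg H => H.IsFormula
  | conj H₁ H₂ => H₁.IsFormula ∧ H₂.IsFormula
  | disj H₁ H₂ => H₁.IsFormula ∧ H₂.IsFormula
  | impl H₁ H₂ => H₁.IsFormula ∧ H₂.IsFormula
  | equi H₁ H₂ => H₁.IsFormula ∧ H₂.IsFormula
  | allInd i H => H.IsFormula ∧ i ∉ H.boundInd
  | exInd i H => H.IsFormula ∧ i ∉ H.boundInd
  | allPred A H => H.IsFormula ∧ ⟨_, A⟩ ∉ H.boundPred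
  | exPred A H => H.IsFormula ∧ ⟨_, A⟩ ∉ H.boundPred

/-- `∀ x₁ ⋯ ∀ xₙ H`. -/
def allTuple {n : ℕ} (x : Fin n → ℕ) (H : Expr) : Expr :=
  (List.ofFn x).foldr allInd H

end Expr

/-- The set `L⁽²⁾` of second-order formulas. -/
def L2 : Set Expr := {H | H.IsFormula}

/-- The set `L⁽²⁾_{x,D}` of the formulas in which `x₁, …, xₙ` and `D` may occur only free
(other free variables are allowed). -/
def L2With {n m : ℕ} (x : Fin n → ℕ) (D : PredVar m) : Set Expr :=
  {H | H ∈ L2 ∧ (∀ i, x i ∉ H.boundInd) ∧ ⟨m, D⟩ ∉ H.boundPred}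

/-- The Ackermann axiom
`∀x ∃D H(x,D) → ∃S ∀x ∃D (∀y (D y ↔ S x y) ∧ H(x,D))`. -/
def choiceH {n m : ℕ} (x : Fin n → ℕ) (y : Fin m → ℕ) (D : PredVar m) (S : PredVar (n + m))
    (H : Expr) : Expr :=
  .impl (.allTuple x (.exPred D H))
    (.exPred S (.allTuple x (.exPred D
      (.conj (.allTuple y (.equi (.rel D y) (.rel S (Fin.append x y)))) H))))

/-! ### Predicate structures, assignments and truth -/

/-- `n`-ary predicates on `I`. -/
abbrev Pred (I : Type*) (n : ℕ) : Type _ := (Fin n → I) → Prop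

/-- A predicate structure with individual domain `I`: non-empty domains `dom n = J_n` of `n`-ary
predicates, `n ≥ 1` (`dom 0` is never used, as there are no predicate variables of sort `0`). -/
structure PredStructure (I : Type*) where
  nonempty_ind : Nonempty I
  dom : ∀ n : ℕ, Set (Pred I n)
  nonempty_dom : ∀ n, 1 ≤ n → (dom n).Nonempty

/-- A map from the variables to individuals and predicates on `I`. -/
structure Assignment (I : Type*) where
  ind : ℕ → I
  pred : ∀ n : ℕ, PredVar n → Pred I n

namespace Assignment

variable {I : Type*}

/-- The assignment that differs from `f` only in giving `ξ` to the variable `x_i`. -/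
def updInd (f : Assignment I) (i : ℕ) (ξ : I) : Assignment I where
  ind := Function.update f.ind i ξ
  pred := f.pred

/-- The assignment that differs from `f` only in giving `α` to the variable `A`. -/
def updPred (f : Assignment I) {n : ℕ} (A : PredVar n) (α : Pred I n) : Assignment I where
  ind := f.ind
  pred := Function.update f.pred n (Function.update (f.pred n) A α)

end Assignment

namespace PredStructure

variable {I : Type*}

/-- The assignments in the structure `M`. -/
def assgn (M : PredStructure I) : Set (Assignment I) :=
  {f | ∀ (n : ℕ) (A : PredVar n), f.pred n A ∈ M.dom n}

/-- Truth in `M` under an assignment; predicate quantifiers of sort `n` range over `M.dom n`. -/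
def Sat (M : PredStructure I) : Expr → Assignment I → Prop
  | .rel A v, f => f.pred _ A (fun k => f.ind (v k))
  | .eqInd i j, f => f.ind i = f.ind j
  | .eqPred A B, f => f.pred _ A = f.pred _ B
  | .neg H, f => ¬ M.Sat H f
  | .conj H₁ H₂, f => M.Sat H₁ f ∧ M.Sat H₂ f
  | .disj H₁ H₂, f => M.Sat H₁ f ∨ M.Sat H₂ f
  | .impl H₁ H₂, f => M.Sat H₁ f → M.Sat H₂ f
  | .equi H₁ H₂, f => (M.Sat H₁ f ↔ M.Sat H₂ f)
  | .allInd i H, f => ∀ ξ : I, M.Sat H (f.updInd i ξ)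
  | .exInd i H, f => ∃ ξ : I, M.Sat H (f.updInd i ξ)
  | .allPred (n := n) A H, f => ∀ α ∈ M.dom n, M.Sat H (f.updPred A α)
  | .exPred (n := n) A H, f => ∃ α ∈ M.dom n, M.Sat H (f.updPred A α)

/-- `M ⊨ H`: the formula is true in `M` under all assignments in `M`. -/
def Models (M : PredStructure I) (H : Expr) : Prop :=
  ∀ f ∈ M.assgn, M.Sat H f

end PredStructure

/-! ### Permutation models -/

section Permutation

variable {I : Type*}

/-- The predicate `α^π`, given by `α^π(ξ) = α(π⁻¹(ξ))`. -/
def Pred.permute {n : ℕ} (π : Equiv.Perm I) (α : Pred I n) : Pred I n :=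
  fun ξ => α (fun k => π⁻¹ (ξ k))

/-- The symmetry subgroup of `G` with respect to `α`. -/
def symGroup (G : Subgroup (Equiv.Perm I)) {n : ℕ} (α : Pred I n) : Subgroup (Equiv.Perm I) where
  carrier := {π | π ∈ G ∧ α.permute π = α}
  one_mem' := ⟨G.one_mem, rfl⟩
  mul_mem' := by
    rintro π ρ ⟨hπ, hα⟩ ⟨hρ, hβ⟩
    refine ⟨G.mul_mem hπ hρ, ?_⟩
    have h : α.permute (π * ρ) = (α.permute ρ).permute π := by
      funext ξ; simp [Pred.permute, mul_inv_rev]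
    rw [h, hβ, hα]
  inv_mem' := by
    rintro π ⟨hπ, hα⟩
    refine ⟨G.inv_mem hπ, ?_⟩
    have h : (α.permute π).permute π⁻¹ = α := by
      funext ξ; simp [Pred.permute]
    rw [hα] at h
    exact h

/-- `G(P)`: the permutations in `G` that fix every element of `P`. -/
def fixGroup (G : Subgroup (Equiv.Perm I)) (P : Set I) : Subgroup (Equiv.Perm I) :=
  G ⊓ fixingSubgroup (Equiv.Perm I) P

/-- The normal filter of finite supports: the subgroups of `G` that include `G(P)` for some
finite `P ⊆ I`. -/
def finSuppFilter (G : Subgroup (Equiv.Perm I)) : Set (Subgroup (Equiv.Perm I)) :=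
  {K | K ≤ G ∧ ∃ P : Set I, P.Finite ∧ fixGroup G P ≤ K}

/-- The permutation model given by `G` and finite supports: its predicates are those whose
symmetry subgroup belongs to the filter of finite supports. -/
def permModel [Nonempty I] (G : Subgroup (Equiv.Perm I)) : PredStructure I where
  nonempty_ind := inferInstance
  dom _ := {α | symGroup G α ∈ finSuppFilter G}
  nonempty_dom _ _ := ⟨fun _ => True, fun _ hπ => hπ.1, ∅, Set.finite_empty,
    fun _ hπ => ⟨hπ.1, rfl⟩⟩

/-- The basic Fraenkel model of second order `Σ₀` over an infinite set `N` of individuals: all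
permutations of `N` and finite supports. -/
def basicFraenkel (N : Type*) [Infinite N] : PredStructure N :=
  permModel (⊤ : Subgroup (Equiv.Perm N))

end Permutation

end HPL

namespace HPL

/-! ### Extending finite partial injections to permutations. -/

section Permutations

variable {N : Type*}

/-! Write `T ξ α` for "`α` is a witness for `D` at the tuple `ξ`". Truth is preserved by permuting
the whole assignment, so `T` is invariant under permutations fixing a finite set `P` that carries
the parameters of `H` (`exists_finset_sat_permute`). What is needed is a choice `ξ ↦ σ ξ` of
witnesses that itself has finite support; `S` is then `σ` uncurried.

Over `P` the tuples have only finitely many equality types, and tuples of one type are conjugate.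
One witness per type thus bounds the support sizes needed, and any such support can be moved,
keeping `P` and the tuple fixed, into a single large finite set `Q` together with the tuple
(`exists_uniform_support`).

Now choose one witness per orbit of the permutations fixing `Q` and transport it along the orbit.
This is unambiguous: a permutation fixing `Q` and the tuple fixes the witness
(`exists_equivariant_choice`). The resulting `σ` is equivariant, so its uncurried form is supported
by `Q`. -/

theorem exists_perm_of_injective {ι : Type*} [Finite ι] {u v : ι → N}
    (hu : Function.Injective u) (hv : Function.Injective v) :
    ∃ π : Equiv.Perm N, ∀ i, π (u i) = v i := by
  obtain ⟨k, ⟨e⟩⟩ := Finite.exists_equiv_fin ι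
  have := Equiv.Perm.isMultiplyPretransitive N k
  obtain ⟨π, hπ⟩ := MulAction.IsPretransitive.exists_smul_eq (M := Equiv.Perm N)
    (⟨u ∘ e.symm, hu.comp e.symm.injective⟩ : Fin k ↪ N)
    ⟨v ∘ e.symm, hv.comp e.symm.injective⟩
  refine ⟨π, fun i => ?_⟩
  simpa using DFunLike.congr_fun hπ (e i)

/-- Both families factor injectively through the quotient of the index type by the kernel of `u`. -/
theorem exists_perm_of_eq_iff {ι : Type*} [Finite ι] {u v : ι → N}
    (h : ∀ a b, u a = u b ↔ v a = v b) : ∃ π : Equiv.Perm N, ∀ i, π (u i) = v i := by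
  let u' : Quotient (Setoid.ker u) → N := Quotient.lift u fun _ _ hab => hab
  let v' : Quotient (Setoid.ker u) → N := Quotient.lift v fun a b hab => (h a b).1 hab
  have hu : Function.Injective u' := by
    rintro ⟨a⟩ ⟨b⟩ hab
    exact Quotient.sound hab
  have hv : Function.Injective v' := by
    rintro ⟨a⟩ ⟨b⟩ hab
    exact Quotient.sound ((h a b).2 hab)
  obtain ⟨π, hπ⟩ := exists_perm_of_injective hu hv
  exact ⟨π, fun i => hπ (Quotient.mk _ i)⟩

/-- The identity on `A` and an injection of `R \ A` into `Q \ A` have disjoint ranges, so together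
they extend to a permutation. -/
theorem exists_perm_image_subset [DecidableEq N] {A R Q : Finset N}
    (h : R.card ≤ (Q \ A).card) :
    ∃ π : Equiv.Perm N, (∀ a ∈ A, π a = a) ∧ R.image π ⊆ Q ∪ A := by
  have hc : Fintype.card ↥(R \ A) ≤ Fintype.card ↥(Q \ A) := by
    simpa only [Fintype.card_coe] using (Finset.card_le_card Finset.sdiff_subset).trans h
  obtain ⟨e⟩ := Function.Embedding.nonempty_of_card_le hc
  obtain ⟨π, hπ⟩ := exists_perm_of_injective (ι := A ⊕ ↥(R \ A))
    (u := Sum.elim Subtype.val Subtype.val)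
    (v := Sum.elim Subtype.val fun r => (e r : N))
    (Subtype.val_injective.sumElim Subtype.val_injective
      fun a b hab => (Finset.mem_sdiff.1 b.2).2 (hab ▸ a.2))
    (Subtype.val_injective.sumElim (Subtype.val_injective.comp e.injective)
      fun a b hab => (Finset.mem_sdiff.1 (e b).2).2 (hab ▸ a.2))
  have hA : ∀ a ∈ A, π a = a := fun a ha => hπ (Sum.inl ⟨a, ha⟩)
  refine ⟨π, hA, fun b hb => ?_⟩
  obtain ⟨r, hr, rfl⟩ := Finset.mem_image.1 hb
  by_cases hrA : r ∈ A
  · rw [hA r hrA]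
    exact Finset.mem_union_right _ hrA
  · have hr' : π r = _ := hπ (Sum.inr ⟨r, Finset.mem_sdiff.2 ⟨hr, hrA⟩⟩)
    rw [hr']
    exact Finset.mem_union_left _ (Finset.mem_sdiff.1 (e _).2).1

end Permutations

/-! ### Supports of predicates. -/

section Supports

variable {N : Type*}

/-- `α` is invariant under all permutations that fix `P` pointwise. -/
def Supports (P : Set N) {n : ℕ} (α : Pred N n) : Prop :=
  ∀ π : Equiv.Perm N, (∀ p ∈ P, π p = p) → α.permute π = α

theorem Pred.permute_mul {n : ℕ} (π ρ : Equiv.Perm N) (α : Pred N n) :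
    α.permute (π * ρ) = (α.permute ρ).permute π := by
  funext ξ
  simp [Pred.permute, mul_inv_rev]

theorem Pred.permute_one {n : ℕ} (α : Pred N n) : α.permute 1 = α := rfl

theorem Supports.mono {P Q : Set N} (h : P ⊆ Q) {n : ℕ} {α : Pred N n} (hα : Supports P α) :
    Supports Q α :=
  fun π hπ => hα π fun p hp => hπ p (h hp)

theorem Supports.permute {P : Set N} {n : ℕ} {α : Pred N n} (hα : Supports P α)
    (ρ : Equiv.Perm N) : Supports (ρ '' P) (α.permute ρ) := by
  intro π hπ
  have h : α.permute (ρ⁻¹ * π * ρ) = α := hα _ fun p hp => by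
    simp [Equiv.Perm.mul_apply, hπ (ρ p) ⟨p, hp, rfl⟩]
  calc (α.permute ρ).permute π = (α.permute (ρ⁻¹ * π * ρ)).permute ρ := by
        rw [← Pred.permute_mul, ← Pred.permute_mul]; congr 1; group
    _ = α.permute ρ := by rw [h]

theorem mem_dom_basicFraenkel [Infinite N] {n : ℕ} {α : Pred N n} :
    α ∈ (basicFraenkel N).dom n ↔ ∃ P : Set N, P.Finite ∧ Supports P α := by
  have key (P : Set N) : fixGroup ⊤ P ≤ symGroup ⊤ α ↔ Supports P α := by
    constructor
    · intro h π hπ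
      exact (h (show π ∈ fixGroup ⊤ P from
        ⟨trivial, (mem_fixingSubgroup_iff _).2 hπ⟩)).2
    · intro h π hπ
      exact ⟨trivial, h π ((mem_fixingSubgroup_iff _).1 hπ.2)⟩
  constructor
  · rintro ⟨-, P, hP, h⟩
    exact ⟨P, hP, (key P).1 h⟩
  · rintro ⟨P, hP, h⟩
    exact ⟨le_top, P, hP, (key P).2 h⟩

end Supports

/-! ### Choosing witnesses equivariantly. -/

section EquivariantChoice

variable {N : Type*} {n m : ℕ} {T : (Fin n → N) → Pred N m → Prop} {P : Finset N}

/-- Witnesses of finite support can be moved so that their supports lie in a fixed finite set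
together with the entries of the tuple. -/
theorem exists_uniform_support [Infinite N]
    (hT : ∀ π : Equiv.Perm N, (∀ p ∈ P, π p = p) → ∀ ξ α, T ξ α → T (π ∘ ξ) (α.permute π))
    (hex : ∀ ξ, ∃ α, (∃ R : Set N, R.Finite ∧ Supports R α) ∧ T ξ α) :
    ∃ Q : Finset N, P ⊆ Q ∧ ∀ η, ∃ α, Supports (Q ∪ Set.range η) α ∧ T η α := by
  classical
  have hex' : ∀ ξ, ∃ α, ∃ R : Finset N, Supports (R : Set N) α ∧ T ξ α := by
    intro ξ
    obtain ⟨α, ⟨R, hR, hs⟩, hα⟩ := hex ξ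
    exact ⟨α, hR.toFinset, by simpa using hs, hα⟩
  choose α R hs hα using hex'
  -- `t ξ` is the equality type of `ξ` over `P`; `Function.invFun t` picks a tuple of each realised
  -- type, and its junk values elsewhere can only enlarge `K`.
  let t : (Fin n → N) → (P ⊕ Fin n) → (P ⊕ Fin n) → Prop := fun ξ a b =>
    Sum.elim Subtype.val ξ a = Sum.elim Subtype.val ξ b
  let K : ℕ := Finset.univ.sup fun c => (R (Function.invFun t c)).card
  -- Removing `P` and the at most `n` entries of any tuple leaves room for a support of size `K`.
  obtain ⟨Q, hPQ, hQ⟩ := Infinite.exists_superset_card_eq P (P.card + n + K) (by omega)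
  refine ⟨Q, hPQ, fun η => ?_⟩
  set ξ := Function.invFun t (t η) with hξ
  have ht : t ξ = t η := Function.invFun_eq ⟨η, rfl⟩
  have hK : (R ξ).card ≤ K :=
    Finset.le_sup (f := fun c => (R (Function.invFun t c)).card) (Finset.mem_univ (t η))
  obtain ⟨ρ, hρ⟩ := exists_perm_of_eq_iff (u := Sum.elim Subtype.val ξ)
    (v := Sum.elim (Subtype.val : P → N) η)
    fun a b => iff_of_eq (congrFun (congrFun ht a) b)
  have hρP : ∀ p ∈ P, ρ p = p := fun p hp => hρ (Sum.inl ⟨p, hp⟩)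
  have hρξ : ρ ∘ ξ = η := funext fun i => hρ (Sum.inr i)
  let A : Finset N := P ∪ Finset.univ.image η
  have hA : A.card ≤ P.card + n :=
    (Finset.card_union_le _ _).trans
      (Nat.add_le_add_left (Finset.card_image_le.trans (by simp)) _)
  obtain ⟨τ, hτA, hτ⟩ := exists_perm_image_subset (A := A) (R := (R ξ).image ρ) (Q := Q) (by
    have h1 := Finset.le_card_sdiff A Q
    have h2 : ((R ξ).image ρ).card ≤ (R ξ).card := Finset.card_image_le
    omega)
  have hτη : τ ∘ η = η := funext fun i =>
    hτA _ (Finset.mem_union_right _ (Finset.mem_image_of_mem _ (Finset.mem_univ i)))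
  refine ⟨((α ξ).permute ρ).permute τ, (((hs ξ).permute ρ).permute τ).mono ?_, ?_⟩
  · have h : (((((R ξ).image ρ).image τ : Finset N)) : Set N) ⊆ ((Q ∪ A : Finset N) : Set N) :=
      Finset.coe_subset.2 hτ
    simp only [A, Finset.coe_image, Finset.coe_union, Finset.coe_univ, Set.image_univ] at h
    refine h.trans ?_
    rintro a (ha | ha | ha)
    · exact Or.inl ha
    · exact Or.inl (hPQ ha)
    · exact Or.inr ha
  · have h1 := hT ρ hρP _ _ (hα ξ)
    rw [hρξ] at h1
    have h2 := hT τ (fun p hp => hτA p (Finset.mem_union_left _ hp)) _ _ h1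
    rwa [hτη] at h2

/-- Witnesses supported by `Q` and the entries of the tuple can be chosen equivariantly with
respect to the permutations that fix `Q` pointwise. -/
theorem exists_equivariant_choice {Q : Set N}
    (hT : ∀ π : Equiv.Perm N, (∀ p ∈ Q, π p = p) → ∀ ξ α, T ξ α → T (π ∘ ξ) (α.permute π))
    (hex : ∀ ξ, ∃ α, Supports (Q ∪ Set.range ξ) α ∧ T ξ α) :
    ∃ σ : (Fin n → N) → Pred N m, (∀ ξ, T ξ (σ ξ)) ∧
      (∀ ξ, Supports (Q ∪ Set.range ξ) (σ ξ)) ∧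
      ∀ π : Equiv.Perm N, (∀ p ∈ Q, π p = p) → ∀ ξ, σ (π ∘ ξ) = (σ ξ).permute π := by
  choose α hs hα using hex
  let s : Setoid (Fin n → N) :=
    { r := fun ξ η => ∃ π : Equiv.Perm N, (∀ p ∈ Q, π p = p) ∧ π ∘ ξ = η
      iseqv :=
        ⟨fun ξ => ⟨1, fun _ _ => rfl, rfl⟩,
        by
          rintro ξ _ ⟨π, hπ, rfl⟩
          exact ⟨π⁻¹, fun p hp => by rw [Equiv.Perm.inv_eq_iff_eq, hπ p hp],
            funext fun i => by simp⟩,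
        by
          rintro ξ _ _ ⟨π, hπ, rfl⟩ ⟨ρ, hρ, rfl⟩
          exact ⟨ρ * π, fun p hp => by rw [Equiv.Perm.mul_apply, hπ p hp, hρ p hp], rfl⟩⟩ }
  let rep : (Fin n → N) → (Fin n → N) := fun η => (Quotient.mk s η).out
  have hrep : ∀ η, ∃ π : Equiv.Perm N, (∀ p ∈ Q, π p = p) ∧ π ∘ rep η = η :=
    fun η => Quotient.mk_out (s := s) η
  choose τ hτ hτrep using hrep
  -- The transporting permutations `τ (π ∘ ξ)` and `π * τ ξ` may differ, but both send the
  -- representative to `π ∘ ξ` and fix `Q`; their quotient therefore fixes the support of the chosen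
  -- witness.
  have hequi : ∀ π : Equiv.Perm N, (∀ p ∈ Q, π p = p) → ∀ ξ,
      (α (rep (π ∘ ξ))).permute (τ (π ∘ ξ)) = ((α (rep ξ)).permute (τ ξ)).permute π := by
    intro π hπ ξ
    have hr : rep (π ∘ ξ) = rep ξ :=
      congrArg Quotient.out (Quotient.sound (s := s) (show s.r ξ (π ∘ ξ) from ⟨π, hπ, rfl⟩)).symm
    have h1 := hτrep (π ∘ ξ)
    rw [hr] at h1 ⊢
    have h : (α (rep ξ)).permute ((τ (π ∘ ξ))⁻¹ * (π * τ ξ)) = α (rep ξ) := by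
      refine hs (rep ξ) _ ?_
      rintro p (hp | ⟨i, rfl⟩)
      · rw [Equiv.Perm.mul_apply, Equiv.Perm.inv_eq_iff_eq, hτ _ p hp, Equiv.Perm.mul_apply,
          hτ _ p hp, hπ p hp]
      · rw [Equiv.Perm.mul_apply, Equiv.Perm.inv_eq_iff_eq, Equiv.Perm.mul_apply]
        exact (congrArg π (congrFun (hτrep ξ) i)).trans (congrFun h1 i).symm
    calc (α (rep ξ)).permute (τ (π ∘ ξ))
        = ((α (rep ξ)).permute ((τ (π ∘ ξ))⁻¹ * (π * τ ξ))).permute (τ (π ∘ ξ)) := by rw [h]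
      _ = ((α (rep ξ)).permute (τ ξ)).permute π := by
        rw [← Pred.permute_mul, ← Pred.permute_mul, mul_inv_cancel_left]
  refine ⟨fun ξ => (α (rep ξ)).permute (τ ξ), fun ξ => ?_, fun ξ π hπ => ?_, hequi⟩
  · have h := hT (τ ξ) (hτ ξ) _ _ (hα (rep ξ))
    rwa [hτrep ξ] at h
  · have h : π ∘ ξ = ξ := funext fun i => hπ _ (Or.inr ⟨i, rfl⟩)
    have h' := hequi π (fun p hp => hπ p (Or.inl hp)) ξ
    rw [h] at h'
    exact h'.symm

end EquivariantChoice

/-! ### Assignments, locality of truth and invariance of truth under permutations. -/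

section Semantics

variable {I : Type*}

namespace Assignment

/-- The assignment that gives the values `ξ` to the variables `x`. -/
noncomputable def updTuple (f : Assignment I) {n : ℕ} (x : Fin n → ℕ) (ξ : Fin n → I) :
    Assignment I where
  ind := Function.extend x ξ f.ind
  pred := f.pred

/-- The image of an assignment under a permutation of the individuals. -/
def permute (π : Equiv.Perm I) (f : Assignment I) : Assignment I where
  ind i := π (f.ind i)
  pred n A := (f.pred n A).permute π

theorem permute_updInd (π : Equiv.Perm I) (f : Assignment I) (i : ℕ) (ξ : I) :
    (f.updInd i ξ).permute π = (f.permute π).updInd i (π ξ) := by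
  simp only [permute, updInd, mk.injEq, and_true]
  funext j
  by_cases h : j = i
  · subst h; simp
  · simp [h]

theorem updPred_pred_self (f : Assignment I) {n : ℕ} (A : PredVar n) (α : Pred I n) :
    (f.updPred A α).pred n A = α := by
  simp [updPred]

theorem updPred_pred_of_ne (f : Assignment I) {n k : ℕ} (A : PredVar n) (α : Pred I n)
    (B : PredVar k) (h : (⟨k, B⟩ : Sigma PredVar) ≠ ⟨n, A⟩) :
    (f.updPred A α).pred k B = f.pred k B := by
  by_cases hk : k = n
  · subst hk
    have hB : B ≠ A := fun hB => h (by rw [hB])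
    simp [updPred, hB]
  · simp [updPred, hk]

theorem permute_updPred (π : Equiv.Perm I) (f : Assignment I) {n : ℕ} (A : PredVar n)
    (α : Pred I n) : (f.updPred A α).permute π = (f.permute π).updPred A (α.permute π) := by
  have h : ((f.updPred A α).permute π).pred = ((f.permute π).updPred A (α.permute π)).pred := by
    funext k B
    by_cases hB : (⟨k, B⟩ : Sigma PredVar) = ⟨n, A⟩
    · cases hB
      rw [updPred_pred_self]
      simp only [permute, updPred_pred_self]
    · rw [updPred_pred_of_ne _ _ _ _ hB]
      simp only [permute, updPred_pred_of_ne _ _ _ _ hB]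
  exact congrArg (Assignment.mk fun i => π (f.ind i)) h

end Assignment

namespace PredStructure

theorem sat_allTuple (M : PredStructure I) (H : Expr) {n : ℕ} (x : Fin n → ℕ)
    (hx : Function.Injective x) (f : Assignment I) :
    M.Sat (.allTuple x H) f ↔ ∀ ξ : Fin n → I, M.Sat H (f.updTuple x ξ) := by
  induction n generalizing f with
  | zero =>
    have h (ξ : Fin 0 → I) : f.updTuple x ξ = f := by
      have : Function.extend x ξ f.ind = f.ind :=
        funext fun j => Function.extend_apply' _ _ _ fun ⟨i, _⟩ => i.elim0
      simp [Assignment.updTuple, this]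
    simp [Expr.allTuple, h]
  | succ n ih =>
    have hx' : Function.Injective fun i : Fin n => x i.succ :=
      hx.comp (Fin.succ_injective n)
    have hupd (ξ₀ : I) (ξ : Fin n → I) :
        (f.updInd (x 0) ξ₀).updTuple (fun i => x i.succ) ξ =
          f.updTuple x (Fin.cons ξ₀ ξ : Fin (n + 1) → I) := by
      simp only [Assignment.updTuple, Assignment.updInd, Assignment.mk.injEq, and_true]
      funext j
      by_cases hj : ∃ i, x i = j
      · obtain ⟨i, rfl⟩ := hj
        rw [hx.extend_apply]
        cases i using Fin.cases with
        | zero =>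
          rw [Function.extend_apply' _ _ _ fun ⟨k, hk⟩ => Fin.succ_ne_zero k (hx hk)]
          simp
        | succ k => exact hx'.extend_apply _ _ k
      · rw [Function.extend_apply' _ _ _ hj,
          Function.extend_apply' _ _ _ fun ⟨k, hk⟩ => hj ⟨_, hk⟩,
          Function.update_of_ne fun h => hj ⟨0, h.symm⟩]
    have hcons : Expr.allTuple x H = .allInd (x 0) (.allTuple (fun i => x i.succ) H) := by
      simp [Expr.allTuple, List.ofFn_succ]
    rw [hcons]
    simp only [Sat, ih _ hx', hupd]
    exact ⟨fun h ξ => by simpa using h (ξ 0) (Fin.tail ξ), fun h ξ₀ ξ => h _⟩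

/-- Truth depends on finitely many individual variables and on the occurring predicate
variables only. -/
theorem exists_sat_congr (M : PredStructure I) (H : Expr) :
    ∃ s : Finset ℕ, ∀ f g : Assignment I, (∀ i ∈ s, f.ind i = g.ind i) →
      (∀ (n : ℕ) (A : PredVar n), ⟨n, A⟩ ∈ H.occPred → f.pred n A = g.pred n A) →
      (M.Sat H f ↔ M.Sat H g) := by
  have hind {s : Finset ℕ} {f g : Assignment I} (h : ∀ i ∈ s, f.ind i = g.ind i) (i : ℕ) (ξ : I) :
      ∀ j ∈ s, (f.updInd i ξ).ind j = (g.updInd i ξ).ind j := by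
    intro j hj
    simp only [Assignment.updInd, Function.update_apply, h j hj]
  have hpred {o : Set (Sigma PredVar)} {f g : Assignment I} {k : ℕ} (B : PredVar k) (α : Pred I k)
      (h : ∀ (n : ℕ) (A : PredVar n), ⟨n, A⟩ ∈ insert ⟨k, B⟩ o → f.pred n A = g.pred n A) :
      ∀ (n : ℕ) (A : PredVar n), ⟨n, A⟩ ∈ o →
        (f.updPred B α).pred n A = (g.updPred B α).pred n A := by
    intro n A hA
    by_cases hB : (⟨n, A⟩ : Sigma PredVar) = ⟨k, B⟩
    · cases hB
      rw [Assignment.updPred_pred_self, Assignment.updPred_pred_self]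
    · rw [Assignment.updPred_pred_of_ne _ _ _ _ hB, Assignment.updPred_pred_of_ne _ _ _ _ hB]
      exact h n A (Or.inr hA)
  induction H with
  | rel A v =>
    refine ⟨Finset.univ.image v, fun f g hi hp => ?_⟩
    have h : (fun k => f.ind (v k)) = fun k => g.ind (v k) :=
      funext fun k => hi _ (Finset.mem_image_of_mem _ (Finset.mem_univ k))
    simp only [Sat, h, hp _ A rfl]
  | eqInd i j =>
    refine ⟨{i, j}, fun f g hi _ => ?_⟩
    simp only [Sat, hi i (by simp), hi j (by simp)]
  | eqPred A B =>
    refine ⟨∅, fun f g _ hp => ?_⟩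
    simp only [Sat, hp _ A (Or.inl rfl), hp _ B (Or.inr rfl)]
  | neg H ih =>
    obtain ⟨s, hs⟩ := ih
    exact ⟨s, fun f g hi hp => not_congr (hs f g hi hp)⟩
  | conj H₁ H₂ ih₁ ih₂ | disj H₁ H₂ ih₁ ih₂ | impl H₁ H₂ ih₁ ih₂ | equi H₁ H₂ ih₁ ih₂ =>
    obtain ⟨s₁, h₁⟩ := ih₁
    obtain ⟨s₂, h₂⟩ := ih₂
    refine ⟨s₁ ∪ s₂, fun f g hi hp => ?_⟩
    simp only [Sat,
      h₁ f g (fun i h => hi i (Finset.mem_union_left _ h)) fun n A h => hp n A (Or.inl h),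
      h₂ f g (fun i h => hi i (Finset.mem_union_right _ h)) fun n A h => hp n A (Or.inr h)]
  | allInd i H ih =>
    obtain ⟨s, hs⟩ := ih
    exact ⟨s, fun f g hi hp => forall_congr' fun ξ => hs _ _ (hind hi i ξ) hp⟩
  | exInd i H ih =>
    obtain ⟨s, hs⟩ := ih
    exact ⟨s, fun f g hi hp => exists_congr fun ξ => hs _ _ (hind hi i ξ) hp⟩
  | allPred A H ih =>
    obtain ⟨s, hs⟩ := ih
    exact ⟨s, fun f g hi hp => forall₂_congr fun α _ => hs _ _ hi (hpred A α hp)⟩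
  | exPred A H ih =>
    obtain ⟨s, hs⟩ := ih
    exact ⟨s, fun f g hi hp => exists_congr fun α => and_congr_right fun _ =>
      hs _ _ hi (hpred A α hp)⟩

/-- Permutations under which the predicate domains are closed preserve truth. -/
theorem sat_permute (M : PredStructure I) (π : Equiv.Perm I)
    (hπ : ∀ (n : ℕ) (α : Pred I n), α ∈ M.dom n ↔ α.permute π ∈ M.dom n) (H : Expr)
    (f : Assignment I) : M.Sat H (f.permute π) ↔ M.Sat H f := by
  -- Surjectivity re-indexes the predicate quantifiers; injectivity settles equations between
  -- predicate variables.
  have hsurj (n : ℕ) : Function.Surjective (Pred.permute π : Pred I n → Pred I n) := fun α =>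
    ⟨α.permute π⁻¹, by rw [← Pred.permute_mul, mul_inv_cancel, Pred.permute_one]⟩
  have hinj (n : ℕ) : Function.Injective (Pred.permute π : Pred I n → Pred I n) :=
    Function.LeftInverse.injective (g := Pred.permute π⁻¹) fun α => by
      rw [← Pred.permute_mul, inv_mul_cancel, Pred.permute_one]
  induction H generalizing f with
  | rel A v => simp [Sat, Assignment.permute, Pred.permute]
  | eqInd i j => simp [Sat, Assignment.permute]
  | eqPred A B => exact (hinj _).eq_iff
  | neg H ih => simp only [Sat, ih]
  | conj H₁ H₂ ih₁ ih₂ | disj H₁ H₂ ih₁ ih₂ | impl H₁ H₂ ih₁ ih₂ | equi H₁ H₂ ih₁ ih₂ =>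
    simp only [Sat, ih₁, ih₂]
  | allInd i H ih =>
    refine π.surjective.forall.trans (forall_congr' fun ξ => ?_)
    rw [← Assignment.permute_updInd]
    exact ih _
  | exInd i H ih =>
    refine π.surjective.exists.trans (exists_congr fun ξ => ?_)
    rw [← Assignment.permute_updInd]
    exact ih _
  | allPred A H ih =>
    refine (hsurj _).forall.trans (forall_congr' fun α => ?_)
    rw [← Assignment.permute_updPred, ← hπ]
    exact imp_congr_right fun _ => ih _
  | exPred A H ih =>
    refine (hsurj _).exists.trans (exists_congr fun α => ?_)
    rw [← Assignment.permute_updPred, ← hπ]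
    exact and_congr_right fun _ => ih _

end PredStructure

end Semantics

theorem Expr.finite_occPred (H : Expr) : H.occPred.Finite := by
  induction H with
  | rel A v => exact Set.finite_singleton _
  | eqInd i j => exact Set.finite_empty
  | eqPred A B => exact (Set.finite_singleton _).insert _
  | neg H ih => exact ih
  | conj H₁ H₂ ih₁ ih₂ | disj H₁ H₂ ih₁ ih₂ | impl H₁ H₂ ih₁ ih₂ | equi H₁ H₂ ih₁ ih₂ =>
    exact ih₁.union ih₂
  | allInd i H ih | exInd i H ih => exact ih
  | allPred A H ih | exPred A H ih => exact ih.insert _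

/-! ### Invariance of definable relations in the basic Fraenkel model. -/

section Fraenkel

variable {N : Type*} [Infinite N]

theorem permute_mem_dom_basicFraenkel (π : Equiv.Perm N) (n : ℕ) (α : Pred N n) :
    α ∈ (basicFraenkel N).dom n ↔ α.permute π ∈ (basicFraenkel N).dom n := by
  have h (π : Equiv.Perm N) (α : Pred N n) (hα : α ∈ (basicFraenkel N).dom n) :
      α.permute π ∈ (basicFraenkel N).dom n := by
    obtain ⟨P, hP, hs⟩ := mem_dom_basicFraenkel.1 hα
    exact mem_dom_basicFraenkel.2 ⟨_, hP.image π, hs.permute π⟩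
  refine ⟨h π α, fun hα => ?_⟩
  have := h π⁻¹ _ hα
  rwa [← Pred.permute_mul, inv_mul_cancel, Pred.permute_one] at this

/-- The truth of a formula in the basic Fraenkel model, as a relation of a tuple of individuals
and a predicate, is invariant under the permutations that fix a finite set of parameters. -/
theorem exists_finset_sat_permute {f : Assignment N} (hf : f ∈ (basicFraenkel N).assgn)
    {n m : ℕ} {x : Fin n → ℕ} (hx : Function.Injective x) (D : PredVar m) (H : Expr) :
    ∃ P : Finset N, ∀ π : Equiv.Perm N, (∀ p ∈ P, π p = p) → ∀ (ξ : Fin n → N) (α : Pred N m),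
      (basicFraenkel N).Sat H ((f.updTuple x ξ).updPred D α) →
      (basicFraenkel N).Sat H ((f.updTuple x (π ∘ ξ)).updPred D (α.permute π)) := by
  classical
  obtain ⟨s, hs⟩ := (basicFraenkel N).exists_sat_congr H
  have hsupp (A : Sigma PredVar) : ∃ P : Set N, P.Finite ∧ Supports P (f.pred A.1 A.2) :=
    mem_dom_basicFraenkel.1 (hf A.1 A.2)
  choose R hR hRs using hsupp
  have hfin : (⋃ A ∈ H.occPred, R A).Finite := H.finite_occPred.biUnion fun A _ => hR A
  -- The values of the individual variables relevant to `H`, together with supports of the values of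
  -- its predicate variables. A permutation fixing them changes `f` only where `H` cannot see it.
  refine ⟨s.image f.ind ∪ hfin.toFinset, fun π hπ ξ α h => ?_⟩
  rw [← (basicFraenkel N).sat_permute π (permute_mem_dom_basicFraenkel π),
    Assignment.permute_updPred] at h
  refine (hs _ _ (fun i hi => ?_) fun k A hA => ?_).1 h
  · change π (Function.extend x ξ f.ind i) = Function.extend x (π ∘ ξ) f.ind i
    by_cases hxi : ∃ j, x j = i
    · obtain ⟨j, rfl⟩ := hxi
      rw [hx.extend_apply, hx.extend_apply, Function.comp_apply]
    · rw [Function.extend_apply' _ _ _ hxi, Function.extend_apply' _ _ _ hxi]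
      exact hπ _ (Finset.mem_union_left _ (Finset.mem_image_of_mem _ hi))
  · by_cases hB : (⟨k, A⟩ : Sigma PredVar) = ⟨m, D⟩
    · cases hB
      rw [Assignment.updPred_pred_self, Assignment.updPred_pred_self]
    · rw [Assignment.updPred_pred_of_ne _ _ _ _ hB, Assignment.updPred_pred_of_ne _ _ _ _ hB]
      refine hRs ⟨k, A⟩ π fun p hp => hπ p (Finset.mem_union_right _ ?_)
      exact hfin.mem_toFinset.2 (Set.mem_biUnion hA hp)

end Fraenkel

end HPL

theorem proposition3 {N : Type*} [Infinite N] (n m : ℕ) (hn : 1 ≤ n) (hm : 1 ≤ m)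
    (x : Fin n → ℕ) (y : Fin m → ℕ) (hxy : Function.Injective (Fin.append x y))
    (D : HPL.PredVar m) (S : HPL.PredVar (n + m))
    (H : HPL.Expr) (hH : H ∈ HPL.L2With x D) (hS : (⟨n + m, S⟩ : Sigma HPL.PredVar) ∉ H.occPred) :
    (HPL.basicFraenkel N).Models (HPL.choiceH x y D S H) := by
  open HPL in
  intro f hf
  have hx : Function.Injective x := fun i j h =>
    Fin.castAdd_injective n m (hxy (by simpa using h))
  have hy : Function.Injective y := fun i j h =>
    Fin.natAdd_injective m n (hxy (by simpa using h))
  have hxney (j : Fin m) (i : Fin n) : x i ≠ y j := fun h => by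
    have h' := hxy (a₁ := Fin.castAdd m i) (a₂ := Fin.natAdd n j) (by simpa using h)
    have := congrArg Fin.val h'
    simp at this
    omega
  have hSD : (⟨n + m, S⟩ : Sigma PredVar) ≠ ⟨m, D⟩ := fun h => by
    have : n + m = m := congrArg Sigma.fst h
    omega
  intro hall
  rw [PredStructure.sat_allTuple _ _ _ hx] at hall
  obtain ⟨P, hP⟩ := exists_finset_sat_permute hf hx D H
  obtain ⟨Q, hPQ, hQ⟩ := exists_uniform_support
    (T := fun ξ α => (basicFraenkel N).Sat H ((f.updTuple x ξ).updPred D α)) hP fun ξ => by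
      obtain ⟨α, hα, h⟩ := hall ξ
      exact ⟨α, mem_dom_basicFraenkel.1 hα, h⟩
  obtain ⟨σ, hσ, hσs, hσe⟩ := exists_equivariant_choice
    (T := fun ξ α => (basicFraenkel N).Sat H ((f.updTuple x ξ).updPred D α))
    (fun π hπ => hP π fun p hp => hπ p (hPQ hp)) hQ
  let β : Pred N (n + m) := fun ζ => σ (fun i => ζ (Fin.castAdd m i)) fun j => ζ (Fin.natAdd n j)
  have hβ : β ∈ (basicFraenkel N).dom (n + m) := by
    refine mem_dom_basicFraenkel.2 ⟨Q, Q.finite_toSet, fun π hπ => ?_⟩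
    funext ζ
    have hπ' : ∀ p ∈ (Q : Set N), π⁻¹ p = p := fun p hp => by
      rw [Equiv.Perm.inv_eq_iff_eq, hπ p hp]
    -- Permuting a predicate applies `π⁻¹` to its arguments, so equivariance is used at `π⁻¹`.
    have h := congrFun (hσe π⁻¹ hπ' fun i => ζ (Fin.castAdd m i))
      fun j => π⁻¹ (ζ (Fin.natAdd n j))
    refine h.trans ?_
    simp [Pred.permute, β]
  refine ⟨β, hβ, ?_⟩
  rw [PredStructure.sat_allTuple _ _ _ hx]
  intro ξ
  refine ⟨σ ξ, mem_dom_basicFraenkel.2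
    ⟨_, Q.finite_toSet.union (Set.finite_range ξ), hσs ξ⟩, ?_, ?_⟩
  · rw [PredStructure.sat_allTuple _ _ _ hy]
    intro υ
    have hindy (j : Fin m) : Function.extend y υ (Function.extend x ξ f.ind) (y j) = υ j :=
      hy.extend_apply _ _ _
    have hindx (i : Fin n) : Function.extend y υ (Function.extend x ξ f.ind) (x i) = ξ i := by
      rw [Function.extend_apply' _ _ _ fun ⟨j, hj⟩ => hxney j i hj.symm, hx.extend_apply]
    have hDp : (((f.updPred S β).updTuple x ξ).updPred D (σ ξ)).pred m D = σ ξ :=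
      Assignment.updPred_pred_self _ _ _
    have hSp : (((f.updPred S β).updTuple x ξ).updPred D (σ ξ)).pred (n + m) S = β :=
      (Assignment.updPred_pred_of_ne _ _ _ _ hSD).trans (Assignment.updPred_pred_self f S β)
    change (((f.updPred S β).updTuple x ξ).updPred D (σ ξ)).pred m D
        (fun j => Function.extend y υ (Function.extend x ξ f.ind) (y j)) ↔
      (((f.updPred S β).updTuple x ξ).updPred D (σ ξ)).pred (n + m) S
        (fun k => Function.extend y υ (Function.extend x ξ f.ind) (Fin.append x y k))
    rw [hDp, hSp]
    simp only [β, Fin.append_left, Fin.append_right, hindx, hindy]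
  -- Giving `S` the value `β` does not affect `H`, where `S` does not occur.
  · obtain ⟨s, hs⟩ := (basicFraenkel N).exists_sat_congr H
    refine (hs ((f.updTuple x ξ).updPred D (σ ξ))
      (((f.updPred S β).updTuple x ξ).updPred D (σ ξ)) (fun i _ => rfl) fun k A hA => ?_).1 (hσ ξ)
    by_cases hB : (⟨k, A⟩ : Sigma PredVar) = ⟨m, D⟩
    · cases hB
      rw [Assignment.updPred_pred_self, Assignment.updPred_pred_self]
    · rw [Assignment.updPred_pred_of_ne _ _ _ _ hB, Assignment.updPred_pred_of_ne _ _ _ _ hB]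
      exact (Assignment.updPred_pred_of_ne f S β A fun h => hS (h ▸ hA)).symm
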